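/- Let $\mathbb{T}^n=\mathbb{R}^n/\mathbb{Z}^n$. A toric hyperplane in $\mathbb{T}^n$ is a preimage $\theta^{-1}(b)$ of a point $b\in S^1=\mathbb{R}/\mathbb{Z}$ under a surjective continuous group homomorphism $\theta:\mathbb{T}^n\to S^1$, and an arrangement $\mathcal{A}$ on $\mathbb{T}^n$ is a finite set of toric hyperplanes. For $H_0\in\mathcal{A}$ let $\mathcal{A}'=\mathcal{A}\setminus\{H_0\}$ be the deletion of $H_0$, an arrangement on $\mathbb{T}^n$, and let $$\mathcal{A}''=\{H_0\cap H : H\in\mathcal{A},\ H_0\not\subseteq H,\ H_0\cap H\ne\emptyset\}$$ be the restriction to $H_0$, an arrangement in the $(n-1)$-dimensional ambient space $H_0$. Let $\mathcal{B}$ be an arrangement in a $d$-dimensional ambient space $X$ (that is, $X=\mathbb{T}^n$ and $d=n$, or $X=H_0$ and $d=n-1$), where the intersection over the empty subset of $\mathcal{B}$ is $X$. It is in general position if any $m\le d$ of its members have an intersection of dimension at most $d-m$ (the empty intersection being allowed) and any $m>d$ of its members have empty intersection. It is spanning if $|\mathcal{B}|\ge d$ and some $d$ of its members have a common point. Let $\pi_0(Y)$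 denote the set of connected components of $Y$. The sets $\Sigma_k(\mathcal{B})$ of $k$-flats are defined inductively by $$\Sigma_k(\mathcal{B})=\bigcup_{S\subseteq\mathcal{B},\ |S|=d-k}\pi_0\Big(\bigcap_{H\in S}H\ \setminus\ \bigcup_{j<k}\ \bigcup_{\sigma\in\Sigma_j(\mathcal{B})}\sigma\Big)\quad\text{for } k=0 \text{ and for } 0<k<d,$$ $$\Sigma_d(\mathcal{B})=\pi_0\Big(X\setminus\bigcup_{H\in\mathcal{B}}H\Big)\quad\text{if } d>0,$$ and $\Sigma_k(\mathcal{B})=\emptyset$ for $k>d$ and for $k<0$. Put $f_k(\mathcal{B})=|\Sigma_k(\mathcal{B})|$; in particular $f_{-1}(\mathcal{B})=0$. **Lemma (generalised deletion-restriction).** Let $\mathcal{A}$ be an arrangement on $\mathbb{T}^n$ with $|\mathcal{A}|\ge n+1$ and let $H_0\in\mathcal{A}$. Assume that $\mathcal{A}$, $\mathcal{A}'$ and $\mathcal{A}''$ are all spanning and in general position, and that every flat of each of them is simply connected. Then $\mathcal{A}$, $\mathcal{A}'$ and $\mathcal{A}''$ have only finitely many flats, and for all $0\le k\le n$, $$f_k(\mathcal{A})=f_k(\mathcal{A}')+f_k(\mathcal{A}'')+f_{k-1}(\mathcal{A}'').$$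 -/

import Mathlib

open Set

/-- The `n`-torus `ℝⁿ/ℤⁿ = (ℝ/ℤ)ⁿ`, a topological group. -/
abbrev Torus (n : ℕ) : Type := Fin n → UnitAddCircle

/-- An (affine) toric hyperplane: the preimage of a point of `S¹ = ℝ/ℤ` under a
surjective continuous group homomorphism `θ : Tⁿ → S¹`. -/
def IsToricHyperplane {n : ℕ} (H : Set (Torus n)) : Prop :=
  ∃ θ : Torus n →+ UnitAddCircle, Continuous θ ∧ Function.Surjective θ ∧
    ∃ b : UnitAddCircle, H = θ ⁻¹' {b}

/-- A toric hyperplane arrangement on `Tⁿ`: a finite set of affine toric hyperplanes. -/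
def IsToricArrangement {n : ℕ} (A : Set (Set (Torus n))) : Prop :=
  A.Finite ∧ ∀ H ∈ A, IsToricHyperplane H

namespace ToricArrangement

/-! Arrangements live either on the whole torus or, for restrictions, on a hyperplane of it. So
the notions below are written for a set `A` of subsets of an ambient set `X ⊆ Tⁿ` of dimension `d`;
for an arrangement on `Tⁿ` itself, `X = univ` and `d = n`. An intersection over a subset `S ⊆ A` is
taken inside the ambient space, so that it is `X` when `S` is empty. -/

variable {n : ℕ}

/-- The deletion of `H₀`. -/
def deletion (A : Set (Set (Torus n))) (H₀ : Set (Torus n)) : Set (Set (Torus n)) :=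
  A \ {H₀}

/-- The restriction of `A` to `X`: all nonempty `X ∩ H`, where `H ∈ A` does not contain `X`.
It is an arrangement in the ambient space `X`. -/
def restriction (A : Set (Set (Torus n))) (X : Set (Torus n)) : Set (Set (Torus n)) :=
  {Y | ∃ H ∈ A, ¬ X ⊆ H ∧ (X ∩ H).Nonempty ∧ Y = X ∩ H}

/-- General position in a `d`-dimensional ambient space: any `m ≤ d` members meet in dimension
at most `d - m`, and any `m > d` members have empty intersection. -/
def IsGeneralPosition (X : Set (Torus n)) (d : ℕ) (A : Set (Set (Torus n))) : Prop :=
  ∀ S : Finset (Set (Torus n)), (S : Set (Set (Torus n))) ⊆ A →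
    (S.card ≤ d → dimH (X ∩ ⋂₀ (S : Set (Set (Torus n)))) ≤ ((d - S.card : ℕ) : ENNReal)) ∧
    (d < S.card → X ∩ ⋂₀ (S : Set (Set (Torus n))) = ∅)

/-- Spanning in a `d`-dimensional ambient space: there are at least `d` members, and some `d` of
them have a common point. -/
def IsSpanning (X : Set (Torus n)) (d : ℕ) (A : Set (Set (Torus n))) : Prop :=
  d ≤ A.ncard ∧ ∃ S : Finset (Set (Torus n)), (S : Set (Set (Torus n))) ⊆ A ∧ S.card = d ∧
    (X ∩ ⋂₀ (S : Set (Set (Torus n)))).Nonempty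

/-- `π₀(Y)`: the set of connected components of `Y`, as subsets of the torus. -/
def components (Y : Set (Torus n)) : Set (Set (Torus n)) :=
  {C | ∃ x ∈ Y, C = connectedComponentIn Y x}

/-- The set of `k`-flats of an arrangement `A` in a `d`-dimensional ambient space `X`, defined
inductively. For `k = 0` and for `0 < k < d` these are the connected components of the sets that
arise from an intersection of `d - k` members of `A` by removing all `j`-flats with `j < k` (none
if `k = 0`); the `d`-flats are the components of the complement of all members; there are no
`k`-flats for `k > d`. -/
def flats (X : Set (Torus n)) (d : ℕ) (A : Set (Set (Torus n))) (k : ℕ) : Set (Set (Torus n)) :=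
  {C | ((k = 0 ∨ k < d) ∧ ∃ S : Finset (Set (Torus n)), (S : Set (Set (Torus n))) ⊆ A ∧
          S.card = d - k ∧
          C ∈ components ((X ∩ ⋂₀ (S : Set (Set (Torus n)))) \
            ⋃ j : {j : ℕ // j < k}, ⋃₀ flats X d A j.1)) ∨
       (0 < k ∧ k = d ∧ C ∈ components (X \ ⋃₀ A))}
termination_by k
decreasing_by exact j.2

/-- `f_k`, the number of `k`-flats; `f_k = 0` for negative `k`. -/
noncomputable def numFlats (X : Set (Torus n)) (d : ℕ) (A : Set (Set (Torus n))) : ℤ → ℕ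
  | Int.ofNat k => (flats X d A k).ncard
  | Int.negSucc _ => 0

/-- Every flat, of every dimension, is simply connected. -/
def FlatsSimplyConnected (X : Set (Torus n)) (d : ℕ) (A : Set (Set (Torus n))) : Prop :=
  ∀ k : ℕ, ∀ σ ∈ flats X d A k, SimplyConnectedSpace σ

end ToricArrangement

/-! Pull everything back to `ℝⁿ`. A toric hyperplane `H` becomes a family of parallel levels `L H -
c H ∈ ℤ`, and the floors and ceilings of these functions cut `ℝⁿ` into convex cells. In general
position the `k`-flats are the components of the strata of points on exactly `n - k` members
(`mem_flats_iff`), and these components are the images of the cells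
(`connectedComponentIn_stratum`). Only finitely many images occur (`finite_image_cells`).

The `k`-flats of `A''` are the `k`-flats of `A` inside `H₀` (`flats_restriction_eq`). The remaining
`k`-flats of `A` lie off `H₀`, each in a unique `k`-flat of `A'`. Since that flat is simply
connected, the covering map is injective on a cell `G` above it (`injOn_torusMk_cell`), so its
pieces can be counted in `G`. The function `L H₀ - c H₀` maps the convex set `G` onto an interval
`I`. The integers in `I` correspond to the `(k-1)`-flats of `A` in the cut by `H₀`, and the open
unit intervals met by `I` to the `k`-flats off `H₀`. By general position `H₀` crosses `G`
transversally (`exists_dual_vector`), so `I` is a neighbourhood of its integers and meets one more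
unit interval than it has integers (`ncard_flatsOff_subset`). Summing over the `k`-flats of `A'`
yields `f_k(A') + f_{k-1}(A'')` flats off `H₀`. -/

namespace ToricArrangement

open Topology Filter

variable {n : ℕ}

/-! ### Lifting hyperplanes to the universal cover -/

/-- The universal covering map `ℝⁿ → Tⁿ`. -/
def torusMk (x : Fin n → ℝ) : Torus n := fun i => (x i : UnitAddCircle)

lemma UnitAddCircle.coe_eq_coe_iff {s t : ℝ} :
    (s : UnitAddCircle) = t ↔ ∃ m : ℤ, s - t = m := by
  rw [← sub_eq_zero, ← AddCircle.coe_sub, AddCircle.coe_eq_zero_iff]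
  simp [eq_comm]

lemma torusMk_surjective : Function.Surjective (torusMk (n := n)) := fun p =>
  ⟨fun i => (p i).out, funext fun i => by simp [torusMk]⟩

lemma continuous_torusMk : Continuous (torusMk (n := n)) :=
  continuous_pi fun i => (AddCircle.continuous_mk' 1).comp (continuous_apply i)

lemma isOpenMap_torusMk : IsOpenMap (torusMk (n := n)) := by
  have h : IsOpenMap (Pi.map fun (_ : Fin n) (t : ℝ) => (t : UnitAddCircle)) :=
    IsOpenMap.piMap (fun _ => QuotientAddGroup.isOpenMap_coe)
      (Eventually.of_forall fun _ => QuotientAddGroup.mk_surjective)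
  exact h

lemma torusMk_add (x y : Fin n → ℝ) : torusMk (x + y) = torusMk x + torusMk y := by
  ext i; simp [torusMk]

/-- `{L = c mod ℤ}` is the preimage of `H` in the universal cover. -/
structure IsLift (H : Set (Torus n)) (L : (Fin n → ℝ) →L[ℝ] ℝ) (c : ℝ) : Prop where
  mem_iff : ∀ x, torusMk x ∈ H ↔ ∃ m : ℤ, L x - c = m
  -- Equivalently, `L` is integral on the lattice `ℤⁿ`.
  sub_eq : ∀ x y, torusMk x = torusMk y → ∃ m : ℤ, L x - L y = m

/-- A continuous character of the universal cover lifts to a linear form. -/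
lemma exists_linear_lift (φ : (Fin n → ℝ) →+ UnitAddCircle) (hφ : Continuous φ) :
    ∃ L : (Fin n → ℝ) →L[ℝ] ℝ, ∀ x, (L x : UnitAddCircle) = φ x := by
  have cov := AddCircle.isCoveringMap_coe (1 : ℝ)
  obtain ⟨f, ⟨hf0, hf⟩, -⟩ := cov.existsUnique_continuousMap_lifts
    (f := (⟨φ, hφ⟩ : C(Fin n → ℝ, UnitAddCircle))) (a₀ := 0) (e₀ := 0) (by simp)
  have hf' : ∀ x, (f x : UnitAddCircle) = φ x := fun x => congrFun hf x
  have hadd : ∀ x y, f (x + y) = f x + f y := by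
    intro x y
    -- Both sides lift the same map on a connected space and agree at `0`.
    have h : (fun q : (Fin n → ℝ) × (Fin n → ℝ) => f (q.1 + q.2)) = fun q => f q.1 + f q.2 := by
      refine cov.eq_of_comp_eq (by fun_prop) (by fun_prop) (funext fun q => ?_) 0 (by simp [hf0])
      simp [hf']
    exact congrFun h (x, y)
  exact ⟨(AddMonoidHom.mk' f hadd).toRealLinearMap f.continuous, hf'⟩

lemma IsToricHyperplane.exists_isLift {H : Set (Torus n)} (hH : IsToricHyperplane H) :
    ∃ L c, IsLift H L c := by
  obtain ⟨θ, hθ, -, b, rfl⟩ := hH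
  obtain ⟨L, hL⟩ := exists_linear_lift
    (θ.comp (AddMonoidHom.mk' torusMk torusMk_add)) (hθ.comp continuous_torusMk)
  have hL' : ∀ x, (L x : UnitAddCircle) = θ (torusMk x) := hL
  obtain ⟨c, rfl⟩ := QuotientAddGroup.mk_surjective b
  refine ⟨L, c, fun x => ?_, fun x y h => ?_⟩
  · rw [← UnitAddCircle.coe_eq_coe_iff, hL']; rfl
  · rw [← UnitAddCircle.coe_eq_coe_iff, hL', hL', h]

/-! ### Cells in `ℝⁿ` and strata on the torus -/

/-- The open cells into which the arrangement of the levels `L H - c H ∈ ℤ`, `H ∈ A`, cuts `ℝⁿ`. -/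
def cell (A : Set (Set (Torus n))) (L : Set (Torus n) → (Fin n → ℝ) →L[ℝ] ℝ)
    (c : Set (Torus n) → ℝ) (y : Fin n → ℝ) : Set (Fin n → ℝ) :=
  {z | ∀ H ∈ A, ⌊L H z - c H⌋ = ⌊L H y - c H⌋ ∧ ⌈L H z - c H⌉ = ⌈L H y - c H⌉}

/-- The set of members of `A` through `p`. -/
def membersThrough (A : Set (Set (Torus n))) (p : Torus n) : Set (Set (Torus n)) :=
  {H ∈ A | p ∈ H}

/-- The points which lie on the same members of `A` as `p`. -/
def stratum (X : Set (Torus n)) (A : Set (Set (Torus n))) (p : Torus n) : Set (Torus n) :=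
  {q ∈ X | ∀ H ∈ A, q ∈ H ↔ p ∈ H}

lemma exists_eq_intCast_iff {t : ℝ} : (∃ m : ℤ, t = m) ↔ ⌈t⌉ = ⌊t⌋ := by
  constructor
  · rintro ⟨m, rfl⟩; simp
  · intro h
    refine ⟨⌊t⌋, le_antisymm ?_ (Int.floor_le t)⟩
    have := Int.le_ceil t
    rwa [h] at this

/-- Near an integer `t` the premise forces `s` to be an integer at distance less than `1`, hence `t`
itself; near any other `t`, floor and ceiling are locally constant. -/
lemma floor_ceil_eventuallyEq (t : ℝ) :
    ∀ᶠ s : ℝ in 𝓝 t, ((∃ m : ℤ, t = m) → ∃ m : ℤ, s = m) → ⌊s⌋ = ⌊t⌋ ∧ ⌈s⌉ = ⌈t⌉ := by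
  by_cases ht : ∃ m : ℤ, t = m
  · obtain ⟨m, rfl⟩ := ht
    filter_upwards [Ioo_mem_nhds (show (m : ℝ) - 1 < m by linarith)
      (show (m : ℝ) < m + 1 by linarith)] with s hs h
    obtain ⟨k, rfl⟩ := h ⟨m, rfl⟩
    have h1 : m - 1 < k := by exact_mod_cast hs.1
    have h2 : k < m + 1 := by exact_mod_cast hs.2
    obtain rfl : k = m := by omega
    simp
  · have h1 : (⌊t⌋ : ℝ) < t := lt_of_le_of_ne (Int.floor_le t) fun h => ht ⟨_, h.symm⟩
    have h2 : t < (⌊t⌋ : ℝ) + 1 := Int.lt_floor_add_one t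
    have key : ∀ s, s ∈ Ioo (⌊t⌋ : ℝ) (⌊t⌋ + 1) → ⌊s⌋ = ⌊t⌋ ∧ ⌈s⌉ = ⌊t⌋ + 1 := fun s hs =>
      ⟨Int.floor_eq_iff.2 ⟨hs.1.le, hs.2⟩,
        Int.ceil_eq_iff.2 ⟨by push_cast; linarith [hs.1], by push_cast; exact hs.2.le⟩⟩
    filter_upwards [Ioo_mem_nhds h1 h2] with s hs _
    exact ⟨(key s hs).1, (key s hs).2.trans (key t ⟨h1, h2⟩).2.symm⟩

section cell

variable {A B : Set (Set (Torus n))} {L : Set (Torus n) → (Fin n → ℝ) →L[ℝ] ℝ}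
  {c : Set (Torus n) → ℝ} {y z : Fin n → ℝ}

lemma mem_cell_self : y ∈ cell A L c y := fun _ _ => ⟨rfl, rfl⟩

lemma cell_eq_of_mem (h : z ∈ cell A L c y) : cell A L c z = cell A L c y := by
  ext w
  exact forall₂_congr fun H hH => by rw [(h H hH).1, (h H hH).2]

lemma cell_anti (h : A ⊆ B) : cell B L c y ⊆ cell A L c y := fun _ hz H hH => hz H (h hH)

/-- Floor and ceiling are monotone, so prescribing both leaves an order-connected set of values,
whose preimage under a linear form is convex. -/
lemma convex_cell : Convex ℝ (cell A L c y) := by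
  have h : cell A L c y = ⋂ H ∈ A, (L H) ⁻¹'
      {t | ⌊t - c H⌋ = ⌊L H y - c H⌋ ∧ ⌈t - c H⌉ = ⌈L H y - c H⌉} := by
    ext; simp [cell]
  rw [h]
  refine convex_iInter₂ fun H _ => Convex.linear_preimage ?_ (L H).toLinearMap
  refine OrdConnected.convex ⟨fun s hs t ht u hu => ?_⟩
  have h1 : s - c H ≤ u - c H := by linarith [hu.1]
  have h2 : u - c H ≤ t - c H := by linarith [hu.2]
  exact ⟨le_antisymm ((Int.floor_mono h2).trans ht.1.le) (hs.1.ge.trans (Int.floor_mono h1)),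
    le_antisymm ((Int.ceil_mono h2).trans ht.2.le) (hs.2.ge.trans (Int.ceil_mono h1))⟩

lemma mem_iff_of_mem_cell (hL : ∀ H ∈ A, IsLift H (L H) (c H)) (h : z ∈ cell A L c y)
    {H : Set (Torus n)} (hH : H ∈ A) : torusMk z ∈ H ↔ torusMk y ∈ H := by
  rw [(hL H hH).mem_iff, (hL H hH).mem_iff, exists_eq_intCast_iff, exists_eq_intCast_iff,
    (h H hH).1, (h H hH).2]

lemma image_cell_subset_stratum (hL : ∀ H ∈ A, IsLift H (L H) (c H)) :
    torusMk '' cell A L c y ⊆ stratum univ A (torusMk y) := by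
  rintro _ ⟨z, hz, rfl⟩
  exact ⟨mem_univ _, fun H hH => mem_iff_of_mem_cell hL hz hH⟩

lemma membersThrough_eq_of_mem_stratum {X : Set (Torus n)} {p q : Torus n}
    (h : q ∈ stratum X A p) : membersThrough A q = membersThrough A p := by
  ext H
  exact and_congr_right fun hH => h.2 H hH

/-- Cells over the same point of the torus are translates of each other. -/
lemma image_cell_eq_of_torusMk_eq (hL : ∀ H ∈ A, IsLift H (L H) (c H))
    (h : torusMk z = torusMk y) : torusMk '' cell A L c z = torusMk '' cell A L c y := by
  have key : ∀ {z y : Fin n → ℝ}, torusMk z = torusMk y →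
      torusMk '' cell A L c z ⊆ torusMk '' cell A L c y := by
    rintro z y h _ ⟨w, hw, rfl⟩
    have h1 : torusMk (w + (y - z)) = torusMk w := by
      have h2 : torusMk (y - z) + torusMk z = torusMk z := by
        rw [← torusMk_add, sub_add_cancel, h]
      rw [torusMk_add, (add_eq_right).1 h2, add_zero]
    refine ⟨w + (y - z), fun H hH => ?_, h1⟩
    obtain ⟨m, hm⟩ := (hL H hH).sub_eq y z h.symm
    have e1 : L H (w + (y - z)) - c H = (L H w - c H) + m := by
      rw [map_add, map_sub, hm]; ring
    have e2 : L H y - c H = (L H z - c H) + m := by rw [← hm]; ring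
    rw [e1, e2]
    simp only [Int.floor_add_intCast, Int.ceil_add_intCast]
    rw [(hw H hH).1, (hw H hH).2]
    exact ⟨rfl, rfl⟩
  exact (key h).antisymm (key h.symm)

lemma image_cell_eq_of_mem (hL : ∀ H ∈ A, IsLift H (L H) (c H))
    (h : torusMk z ∈ torusMk '' cell A L c y) :
    torusMk '' cell A L c z = torusMk '' cell A L c y := by
  obtain ⟨w, hw, hwz⟩ := h
  rw [image_cell_eq_of_torusMk_eq hL hwz.symm, cell_eq_of_mem hw]

/-- A small move can change the cell only by leaving a member through the starting point. This makes
cells relatively open in the preimage of their stratum. -/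
lemma eventually_mem_cell (hA : A.Finite) (hL : ∀ H ∈ A, IsLift H (L H) (c H)) :
    ∀ᶠ w in 𝓝 z, (∀ H ∈ A, torusMk z ∈ H → torusMk w ∈ H) → w ∈ cell A L c z := by
  have h : ∀ᶠ w in 𝓝 z, ∀ H ∈ A, (torusMk z ∈ H → torusMk w ∈ H) →
      ⌊L H w - c H⌋ = ⌊L H z - c H⌋ ∧ ⌈L H w - c H⌉ = ⌈L H z - c H⌉ := by
    refine (eventually_all_finite hA).2 fun H hH => ?_
    have hc : ContinuousAt (fun w => L H w - c H) z := by fun_prop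
    filter_upwards [hc.eventually (floor_ceil_eventuallyEq (L H z - c H))] with w hw h
    rw [(hL H hH).mem_iff, (hL H hH).mem_iff] at h
    exact hw h
  filter_upwards [h] with w hw hs H hH
  exact hw H hH (hs H hH)

/-- The connected components of the strata are the images of the cells. -/
lemma connectedComponentIn_stratum (hA : A.Finite) (hL : ∀ H ∈ A, IsLift H (L H) (c H)) :
    connectedComponentIn (stratum univ A (torusMk y)) (torusMk y) = torusMk '' cell A L c y := by
  have hy : torusMk y ∈ stratum univ A (torusMk y) := ⟨mem_univ _, fun _ _ => Iff.rfl⟩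
  refine Subset.antisymm ?_ ((convex_cell.isPreconnected.image _
    continuous_torusMk.continuousOn).subset_connectedComponentIn ⟨y, mem_cell_self, rfl⟩
    (image_cell_subset_stratum hL))
  have hnear : ∀ z, torusMk z ∈ stratum univ A (torusMk y) →
      ∀ᶠ q in 𝓝 (torusMk z), q ∈ stratum univ A (torusMk y) →
        ∃ w ∈ cell A L c z, torusMk w = q := by
    intro z hz
    refine mem_of_superset (isOpenMap_torusMk.image_mem_nhds
      (eventually_mem_cell (z := z) hA hL)) ?_
    rintro _ ⟨w, hw, rfl⟩ hq
    exact ⟨w, hw fun H hH h => (hq.2 H hH).2 ((hz.2 H hH).1 h), rfl⟩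
  -- Images of cells partition the stratum into relatively open pieces, so each piece is also
  -- closed.
  have hclopen : IsClopen {q : stratum univ A (torusMk y) | q.1 ∈ torusMk '' cell A L c y} := by
    refine ⟨⟨isOpen_iff_mem_nhds.2 ?_⟩, isOpen_iff_mem_nhds.2 ?_⟩
    · rintro ⟨q, hq⟩ hqc
      obtain ⟨z, rfl⟩ := torusMk_surjective q
      filter_upwards [continuous_subtype_val.continuousAt.eventually (hnear z hq)] with r hr hrc
      obtain ⟨w, hw, hwr⟩ := hr r.2
      have hrc' : torusMk w ∈ torusMk '' cell A L c y := hwr ▸ hrc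
      refine hqc ?_
      change torusMk z ∈ torusMk '' cell A L c y
      rw [← image_cell_eq_of_mem hL hrc', cell_eq_of_mem hw]
      exact ⟨z, mem_cell_self, rfl⟩
    · rintro ⟨q, hq⟩ hqc
      obtain ⟨z, hz, rfl⟩ := hqc
      filter_upwards [continuous_subtype_val.continuousAt.eventually (hnear z hq)] with r hr
      obtain ⟨w, hw, hwr⟩ := hr r.2
      exact ⟨w, cell_eq_of_mem hz ▸ hw, hwr⟩
  rw [connectedComponentIn_eq_image hy]
  rintro _ ⟨q, hq, rfl⟩
  exact hclopen.connectedComponent_subset (x := ⟨torusMk y, hy⟩) ⟨y, mem_cell_self, rfl⟩ hq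

/-- Only finitely many sets are images of cells. -/
lemma finite_image_cells (hA : A.Finite) (hL : ∀ H ∈ A, IsLift H (L H) (c H)) :
    {C | ∃ y, C = torusMk '' cell A L c y}.Finite := by
  have hfr : ∀ y : Fin n → ℝ, torusMk (fun i => Int.fract (y i)) = torusMk y := fun y => by
    ext i
    exact UnitAddCircle.coe_eq_coe_iff.2 ⟨-⌊y i⌋, by
      push_cast; linarith [Int.floor_add_fract (y i)]⟩
  have hK : IsCompact (Icc (0 : Fin n → ℝ) 1) := isCompact_Icc
  have hb : ∀ H : Set (Torus n), ∃ R : ℝ, ∀ x ∈ Icc (0 : Fin n → ℝ) 1, |L H x - c H| ≤ R :=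
    fun H => (hK.exists_bound_of_continuousOn (f := fun x => L H x - c H) (by fun_prop))
  choose R hR using hb
  have : Finite A := hA
  let data : (Fin n → ℝ) → A → ℤ × ℤ := fun y H => (⌊L H y - c H⌋, ⌈L H y - c H⌉)
  -- Every point of the torus has a lift in the unit cube, where the forms are bounded and take
  -- finitely many floors and ceilings.
  have hfin : (data '' Icc 0 1).Finite := by
    refine (Set.Finite.pi' fun H : A =>
      ((finite_Icc ⌊-R H⌋ ⌊R H⌋).prod (finite_Icc ⌈-R H⌉ ⌈R H⌉))).subset ?_
    rintro _ ⟨y, hy, rfl⟩ H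
    have h := abs_le.1 (hR H y hy)
    exact ⟨⟨Int.floor_mono h.1, Int.floor_mono h.2⟩, ⟨Int.ceil_mono h.1, Int.ceil_mono h.2⟩⟩
  have hcell : ∀ y z, data y = data z → cell A L c y = cell A L c z := by
    intro y z h
    refine cell_eq_of_mem fun H hH => ?_
    have := congrFun h ⟨H, hH⟩
    exact Prod.ext_iff.1 this
  choose! s hs using fun d (hd : d ∈ data '' Icc 0 1) => hd
  refine (hfin.image fun d => torusMk '' cell A L c (s d)).subset ?_
  rintro _ ⟨y, rfl⟩
  have hmem : (fun i => Int.fract (y i)) ∈ Icc (0 : Fin n → ℝ) 1 :=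
    ⟨fun i => Int.fract_nonneg _, fun i => (Int.fract_lt_one _).le⟩
  refine ⟨_, mem_image_of_mem data hmem, ?_⟩
  simp only
  rw [hcell _ _ (hs _ (mem_image_of_mem data hmem)).2]
  exact image_cell_eq_of_torusMk_eq hL (hfr y)

/-- The covering map is injective on a cell whose image is simply connected. -/
lemma injOn_torusMk_cell (hsc : SimplyConnectedSpace (torusMk '' cell A L c y)) :
    InjOn torusMk (cell A L c y) := by
  intro u hu v hv huv
  have hseg : ∀ t : unitInterval, u + (t : ℝ) • (v - u) ∈ cell A L c y := fun t =>
    convex_cell.add_smul_sub_mem hu hv t.2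
  have hcont : Continuous fun t : unitInterval => u + (t : ℝ) • (v - u) := by fun_prop
  -- The segment from `u` to `v` projects to a loop. Lifting a null-homotopy of it, one coordinate
  -- at a time, keeps the endpoints fixed and so gives `u = v`.
  let x₀ : torusMk '' cell A L c y := ⟨torusMk u, u, hu, rfl⟩
  let γ : Path x₀ x₀ :=
    { toFun := fun t => ⟨torusMk (u + (t : ℝ) • (v - u)), _, hseg t, rfl⟩
      continuous_toFun := (continuous_torusMk.comp hcont).subtype_mk _
      source' := by simp [x₀]
      target' := by simp [x₀, huv] }
  obtain ⟨F⟩ := SimplyConnectedSpace.paths_homotopic γ (Path.refl x₀)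
  have F' : (γ : C(unitInterval, torusMk '' cell A L c y)).HomotopyRel
    (Path.refl x₀ : C(unitInterval, torusMk '' cell A L c y)) {0, 1} := F
  funext i
  have cov := AddCircle.isCoveringMap_coe (1 : ℝ)
  let g : C(torusMk '' cell A L c y, UnitAddCircle) :=
    ⟨fun q => q.1 i, (continuous_apply i).comp continuous_subtype_val⟩
  let f₀ : C(unitInterval, ℝ) := ⟨fun t => u i + (t : ℝ) * (v i - u i), by fun_prop⟩
  let f₁ : C(unitInterval, ℝ) := ⟨fun _ => u i, by fun_prop⟩
  have h := (cov.homotopicRel_iff_comp (f₀ := f₀) (f₁ := f₁) (S := {0, 1})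
    ⟨0, by simp, by simp [f₀, f₁]⟩).2 ⟨F'.compContinuousMap g⟩
  obtain ⟨G⟩ := h
  have h1 := G.eq_fst 0 (x := 1) (by simp)
  have h2 := G.eq_snd 0 (x := 1) (by simp)
  have h3 : f₀ 1 = f₁ 1 := h1.symm.trans h2
  simpa [f₀, f₁] using h3.symm

end cell

/-! ### Local isometry and Hausdorff dimension -/

lemma dist_torusMk {a b : Fin n → ℝ} (h : dist a b ≤ 1 / 2) :
    dist (torusMk a) (torusMk b) = dist a b := by
  have hi : ∀ i, dist (torusMk a i) (torusMk b i) = dist (a i) (b i) := fun i => by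
    rw [dist_eq_norm, Real.dist_eq]
    simp only [torusMk]
    rw [← AddCircle.coe_sub, AddCircle.norm_coe_eq_abs_iff (1 : ℝ) one_ne_zero, ← Real.dist_eq,
      abs_one]
    exact (dist_le_pi_dist a b i).trans h
  refine le_antisymm ((dist_pi_le_iff dist_nonneg).2 fun i => ?_)
    ((dist_pi_le_iff dist_nonneg).2 fun i => ?_)
  · rw [hi]; exact dist_le_pi_dist a b i
  · rw [← hi]; exact dist_le_pi_dist _ _ i

/-- The image of an affine subspace in the torus has at least the dimension of the subspace. -/
lemma finrank_le_dimH_image (V : Submodule ℝ (Fin n → ℝ)) (y : Fin n → ℝ) :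
    (Module.finrank ℝ V : ENNReal) ≤ dimH (range fun v : V => torusMk (y + (v : Fin n → ℝ))) := by
  -- Radius `1 / 4` keeps mutual distances below `1 / 2`, where the covering map is isometric.
  let D := Metric.ball (0 : V) (1 / 4)
  have hf : Isometry fun v : D => torusMk (y + ((v : V) : Fin n → ℝ)) := by
    refine Isometry.of_dist_eq fun u v => ?_
    have h1 : dist (y + ((u : V) : Fin n → ℝ)) (y + ((v : V) : Fin n → ℝ)) = dist u v := by
      rw [dist_add_left]; rfl
    have h2 : dist u v ≤ 1 / 2 := by
      have := dist_triangle_right (u : V) v 0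
      have hu := Metric.mem_ball.1 u.2
      have hv := Metric.mem_ball.1 v.2
      rw [Subtype.dist_eq]
      linarith
    rw [dist_torusMk (h1.trans_le h2), h1]
  have hD : dimH D = Module.finrank ℝ V :=
    Real.dimH_of_mem_nhds (Metric.ball_mem_nhds (0 : V) (by norm_num))
  have h1 := hf.dimH_image univ
  have h2 := (isometry_subtype_coe (s := D)).dimH_image univ
  rw [image_univ, Subtype.range_coe, hD] at h2
  rw [h2, ← h1]
  refine dimH_mono ?_
  rintro _ ⟨v, -, rfl⟩
  exact ⟨v, rfl⟩

/-! ### General position and the description of flats -/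

section

variable {A : Set (Set (Torus n))} {L : Set (Torus n) → (Fin n → ℝ) →L[ℝ] ℝ}
  {c : Set (Torus n) → ℝ} {y : Fin n → ℝ}

lemma finite_membersThrough (hA : A.Finite) (p : Torus n) : (membersThrough A p).Finite :=
  hA.subset fun _ h => h.1

lemma ncard_membersThrough_le {X : Set (Torus n)} {d : ℕ} (hA : A.Finite)
    (hgen : IsGeneralPosition X d A) {p : Torus n} (hp : p ∈ X) :
    (membersThrough A p).ncard ≤ d := by
  by_contra! h
  have hfin := finite_membersThrough hA p
  rw [ncard_eq_toFinset_card _ hfin] at h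
  have h2 := (hgen hfin.toFinset (by
    rw [Finite.coe_toFinset]; exact fun H hH => hH.1)).2 h
  refine notMem_empty p (h2 ▸ ⟨hp, fun H hH => ?_⟩)
  exact (hfin.mem_toFinset.1 hH).2

/-- In general position, the linear forms defining the members through a point admit dual
vectors. -/
lemma exists_dual_vector (hA : A.Finite) (hL : ∀ H ∈ A, IsLift H (L H) (c H))
    (hgen : IsGeneralPosition univ n A) {H : Set (Torus n)}
    (hH : H ∈ membersThrough A (torusMk y)) :
    ∃ v, L H v = 1 ∧ ∀ K ∈ membersThrough A (torusMk y), K ≠ H → L K v = 0 := by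
  classical
  by_contra! hno
  have hfin := finite_membersThrough hA (torusMk y)
  set S := hfin.toFinset with hS
  have hmemS : ∀ {K}, K ∈ S ↔ K ∈ membersThrough A (torusMk y) := hfin.mem_toFinset
  have hSA : (S : Set (Set (Torus n))) ⊆ A := fun K hK => (hmemS.1 hK).1
  have hcard : S.card ≤ n := by
    have := ncard_membersThrough_le hA hgen (mem_univ (torusMk y))
    rwa [ncard_eq_toFinset_card _ hfin] at this
  have hpos : 0 < S.card := Finset.card_pos.2 ⟨H, hmemS.2 hH⟩
  -- Without a dual vector, `L H` vanishes wherever the other `S.card - 1` forms do. Their common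
  -- kernel, of dimension at least `n - S.card + 1`, then translates into the intersection of `S`,
  -- which is too small for it.
  let Φ : (Fin n → ℝ) →ₗ[ℝ] (S.erase H → ℝ) :=
    LinearMap.pi fun K => (L K.1).toLinearMap
  have hΦ : ∀ v ∈ LinearMap.ker Φ, ∀ K ∈ S, L K v = 0 := by
    intro v hv
    have h0 : ∀ K ∈ S, K ≠ H → L K v = 0 := fun K hK hKH =>
      congrFun (LinearMap.mem_ker.1 hv) ⟨K, Finset.mem_erase.2 ⟨hKH, hK⟩⟩
    intro K hK
    by_cases hKH : K = H
    · subst hKH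
      by_contra hne
      obtain ⟨K', hK', hne', h'⟩ := hno ((L K v)⁻¹ • v) (by simp [hne])
      exact h' (by rw [map_smul, h0 K' (hmemS.2 hK') hne', smul_zero])
    · exact h0 K hK hKH
  have hsub : (range fun v : LinearMap.ker Φ => torusMk (y + (v : Fin n → ℝ))) ⊆
      univ ∩ ⋂₀ (S : Set (Set (Torus n))) := by
    rintro _ ⟨v, rfl⟩
    refine ⟨mem_univ _, fun K hK => ?_⟩
    have hKA := hSA hK
    obtain ⟨m, hm⟩ := ((hL K hKA).mem_iff y).1 (hmemS.1 hK).2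
    exact ((hL K hKA).mem_iff _).2 ⟨m, by rw [map_add, hΦ v v.2 K hK, add_zero, hm]⟩
  have hdim := ((finrank_le_dimH_image _ y).trans (dimH_mono hsub)).trans ((hgen S hSA).1 hcard)
  have hdim' : Module.finrank ℝ (LinearMap.ker Φ) ≤ n - S.card := by exact_mod_cast hdim
  have hrn := Φ.finrank_range_add_finrank_ker
  have hr : Module.finrank ℝ (LinearMap.range Φ) ≤ S.card - 1 := by
    refine (Submodule.finrank_le _).trans ?_
    rw [Module.finrank_fintype_fun_eq_card, Fintype.card_coe, Finset.card_erase_of_mem (hmemS.2 hH)]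
  rw [Module.finrank_fin_fun] at hrn
  omega

lemma mem_stratum_self {X : Set (Torus n)} {p : Torus n} (hp : p ∈ X) : p ∈ stratum X A p :=
  ⟨hp, fun _ _ => Iff.rfl⟩

lemma mem_stratum_iff {X : Set (Torus n)} {p q : Torus n} :
    q ∈ stratum X A p ↔ q ∈ X ∧ membersThrough A q = membersThrough A p := by
  refine ⟨fun h => ⟨h.1, membersThrough_eq_of_mem_stratum h⟩, fun h => ⟨h.1, fun H hH => ?_⟩⟩
  have := Set.ext_iff.1 h.2 H
  exact ⟨fun hq => (this.1 ⟨hH, hq⟩).2, fun hp => (this.2 ⟨hH, hp⟩).2⟩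

/-- The `k`-flats are the components of the strata of points on exactly `d - k` members. -/
lemma mem_flats_iff {X : Set (Torus n)} {d : ℕ} (hA : A.Finite) (hgen : IsGeneralPosition X d A)
    (k : ℕ) (C : Set (Torus n)) :
    C ∈ flats X d A k ↔ ∃ p ∈ X, (membersThrough A p).ncard + k = d ∧
      C = connectedComponentIn (stratum X A p) p := by
  induction k using Nat.strong_induction_on generalizing C with
  | _ k ih =>
  -- Removing the lower flats removes exactly the points on more than `d - k` members.
  have hlow : (⋃ j : {j : ℕ // j < k}, ⋃₀ flats X d A j.1) =
      {q ∈ X | d < (membersThrough A q).ncard + k} := by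
    ext q
    simp only [mem_iUnion, mem_sUnion, Subtype.exists, mem_ofPred_eq]
    constructor
    · rintro ⟨j, hj, σ, hσ, hq⟩
      obtain ⟨p, hp, hpd, rfl⟩ := (ih j hj σ).1 hσ
      obtain ⟨hqX, hqp⟩ := mem_stratum_iff.1 (connectedComponentIn_subset _ _ hq)
      exact ⟨hqX, by rw [hqp]; omega⟩
    · rintro ⟨hqX, hq⟩
      have := ncard_membersThrough_le hA hgen hqX
      exact ⟨d - (membersThrough A q).ncard, by omega, _,
        (ih _ (by omega) _).2 ⟨q, hqX, by omega, rfl⟩,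
        mem_connectedComponentIn (mem_stratum_self hqX)⟩
  rw [flats, hlow]
  have hempty : ∀ {q}, q ∈ X → (q ∉ ⋃₀ A ↔ membersThrough A q = ∅) := by
    intro q _
    rw [eq_empty_iff_forall_notMem]
    simp [membersThrough]
  have htop : ∀ {p}, p ∈ X → membersThrough A p = ∅ → X \ ⋃₀ A = stratum X A p := by
    intro p hp hpe
    ext q
    rw [mem_stratum_iff, hpe]
    exact and_congr_right fun hq => hempty hq
  have hmid : ∀ {p} {S : Finset (Set (Torus n))}, p ∈ X → S.card + k = d →
      membersThrough A p = S →
      (X ∩ ⋂₀ (S : Set (Set (Torus n)))) \ {q ∈ X | d < (membersThrough A q).ncard + k} =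
        stratum X A p := by
    intro p S hp hS hpS
    have hSA : (S : Set (Set (Torus n))) ⊆ A := hpS ▸ fun _ h => h.1
    ext q
    rw [mem_stratum_iff, hpS]
    constructor
    · rintro ⟨⟨hqX, hqS⟩, hq⟩
      refine ⟨hqX, (eq_of_subset_of_ncard_le (show _ ⊆ membersThrough A _ from fun H hH => ⟨hSA hH, hqS H hH⟩) ?_
        (finite_membersThrough hA q)).symm⟩
      have : ¬ d < (membersThrough A q).ncard + k := fun h => hq ⟨hqX, h⟩
      rw [ncard_coe_finset]
      omega
    · rintro ⟨hqX, hqS⟩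
      refine ⟨⟨hqX, fun H hH => ?_⟩, fun h => ?_⟩
      · rw [← hqS] at hH
        exact hH.2
      · have := h.2
        rw [hqS, ncard_coe_finset] at this
        omega
  constructor
  · rintro (⟨hk, S, hSA, hS, p, ⟨⟨hpX, hpS⟩, hp⟩, rfl⟩ | ⟨-, rfl, p, ⟨hpX, hp⟩, rfl⟩)
    · have hle : (membersThrough A p).ncard + k ≤ d := by
        by_contra! h
        exact hp ⟨hpX, h⟩
      have hpS' : membersThrough A p = S := by
        refine (eq_of_subset_of_ncard_le (show _ ⊆ membersThrough A _ from fun H hH => ⟨hSA hH, hpS H hH⟩) ?_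
          (finite_membersThrough hA p)).symm
        rw [ncard_coe_finset]
        omega
      refine ⟨p, hpX, ?_, ?_⟩
      · rw [hpS', ncard_coe_finset]
        omega
      · rw [hmid hpX (by omega) hpS']
    · have hpe := (hempty hpX).1 hp
      exact ⟨p, hpX, by simp [hpe], by rw [htop hpX hpe]⟩
  · rintro ⟨p, hpX, hpd, rfl⟩
    by_cases hk : k = 0 ∨ k < d
    · have hfin := finite_membersThrough hA p
      have hc := ncard_eq_toFinset_card _ hfin
      refine Or.inl ⟨hk, hfin.toFinset, by
        rw [Finite.coe_toFinset]; exact fun H hH => hH.1, by omega, p, ?_⟩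
      have := hmid (S := hfin.toFinset) hpX (by omega) (by simp)
      rw [this]
      exact ⟨mem_stratum_self hpX, rfl⟩
    -- Here `k = d > 0`; the case `k = d = 0` falls under the first clause of `flats`.
    · have h0 : (membersThrough A p).ncard = 0 := by omega
      have hpe := (ncard_eq_zero (finite_membersThrough hA p)).1 h0
      refine Or.inr ⟨by omega, by omega, p, ?_⟩
      rw [htop hpX hpe]
      exact ⟨mem_stratum_self hpX, rfl⟩

/-- The flats of an arrangement on the torus are the images of the cells. -/
lemma flats_univ_eq (hA : A.Finite) (hL : ∀ H ∈ A, IsLift H (L H) (c H))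
    (hgen : IsGeneralPosition univ n A) (k : ℕ) :
    flats univ n A k = {C | ∃ y, (membersThrough A (torusMk y)).ncard + k = n ∧
      C = torusMk '' cell A L c y} := by
  ext C
  rw [mem_flats_iff hA hgen]
  constructor
  · rintro ⟨p, -, hp, rfl⟩
    obtain ⟨y, rfl⟩ := torusMk_surjective p
    exact ⟨y, hp, connectedComponentIn_stratum hA hL⟩
  · rintro ⟨y, hy, rfl⟩
    exact ⟨_, mem_univ _, hy, (connectedComponentIn_stratum hA hL).symm⟩

/-! ### Restriction to `H₀` -/

/-- The trace on `H₀` of a member through a point of `H₀` is a member of the restriction, and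
different members have different traces. -/
lemma membersThrough_restriction (hA : A.Finite) (hL : ∀ H ∈ A, IsLift H (L H) (c H))
    (hgen : IsGeneralPosition univ n A) {H₀ : Set (Torus n)} (hH₀ : H₀ ∈ A) {p : Torus n}
    (hp : p ∈ H₀) :
    membersThrough (restriction A H₀) p = (H₀ ∩ ·) '' (membersThrough A p \ {H₀}) ∧
      InjOn (H₀ ∩ ·) (membersThrough A p \ {H₀}) := by
  obtain ⟨y, rfl⟩ := torusMk_surjective p
  have hmove : ∀ K ∈ membersThrough A (torusMk y), ∀ v t, L K v = t →
      (torusMk (y + v) ∈ K ↔ ∃ m : ℤ, t = m) := by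
    rintro K hK v _ rfl
    obtain ⟨m, hm⟩ := ((hL K hK.1).mem_iff y).1 hK.2
    rw [(hL K hK.1).mem_iff]
    have e : L K (y + v) - c K = m + L K v := by rw [map_add, ← hm]; ring
    rw [e]
    exact ⟨fun ⟨j, hj⟩ => ⟨j - m, by push_cast; linarith⟩,
      fun ⟨j, hj⟩ => ⟨m + j, by push_cast; linarith⟩⟩
  have hhalf : ¬ ∃ m : ℤ, (1 / 2 : ℝ) = m := by
    rintro ⟨m, hm⟩
    have : (1 : ℝ) = ((2 * m : ℤ) : ℝ) := by push_cast; linarith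
    have : (1 : ℤ) = 2 * m := by exact_mod_cast this
    omega
  have hsep : ∀ K ∈ membersThrough A (torusMk y), ∃ q, q ∉ K ∧
      ∀ K' ∈ membersThrough A (torusMk y), K' ≠ K → q ∈ K' := by
    intro K hK
    obtain ⟨v, hv, hv'⟩ := exists_dual_vector hA hL hgen hK
    -- Half a step along the dual vector changes `L K` by a non-integer and no other form through
    -- the point.
    refine ⟨torusMk (y + (1 / 2 : ℝ) • v), fun h => hhalf ?_, fun K' hK' hne => ?_⟩
    · exact (hmove K hK _ _ (by rw [map_smul, hv]; simp)).1 h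
    · exact (hmove K' hK' _ 0 (by rw [map_smul, hv' K' hK' hne]; simp)).2 ⟨0, by simp⟩
  have h0 : H₀ ∈ membersThrough A (torusMk y) := ⟨hH₀, hp⟩
  constructor
  · ext Y
    constructor
    · rintro ⟨⟨H, hH, hsub, -, rfl⟩, hpY⟩
      exact ⟨H, ⟨⟨hH, hpY.2⟩, fun h => hsub (h ▸ Subset.rfl)⟩, rfl⟩
    · rintro ⟨H, ⟨hH, hne⟩, rfl⟩
      refine ⟨⟨H, hH.1, fun hsub => ?_, ⟨_, hp, hH.2⟩, rfl⟩, hp, hH.2⟩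
      obtain ⟨q, hq, hq'⟩ := hsep H hH
      exact hq (hsub (hq' H₀ h0 (Ne.symm hne)))
  · rintro H ⟨hH, hne⟩ K ⟨hK, hne'⟩ h
    by_contra hHK
    obtain ⟨q, hq, hq'⟩ := hsep K hK
    have : q ∈ H₀ ∩ K := by
      rw [← show H₀ ∩ H = H₀ ∩ K from h]
      exact ⟨hq' H₀ h0 (Ne.symm hne'), hq' H hH hHK⟩
    exact hq this.2

lemma ncard_membersThrough_restriction (hA : A.Finite) (hL : ∀ H ∈ A, IsLift H (L H) (c H))
    (hgen : IsGeneralPosition univ n A) {H₀ : Set (Torus n)} (hH₀ : H₀ ∈ A) {p : Torus n}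
    (hp : p ∈ H₀) :
    (membersThrough (restriction A H₀) p).ncard + 1 = (membersThrough A p).ncard := by
  obtain ⟨h, hinj⟩ := membersThrough_restriction hA hL hgen hH₀ hp
  rw [h, hinj.ncard_image]
  exact ncard_sdiff_singleton_add_one ⟨hH₀, hp⟩ (finite_membersThrough hA p)

/-- At a point of `H₀`, the members of `A` through it and their traces on `H₀` determine each other.
-/
lemma stratum_restriction (hA : A.Finite) (hL : ∀ H ∈ A, IsLift H (L H) (c H))
    (hgen : IsGeneralPosition univ n A) {H₀ : Set (Torus n)} (hH₀ : H₀ ∈ A) {p : Torus n}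
    (hp : p ∈ H₀) : stratum H₀ (restriction A H₀) p = stratum univ A p := by
  have key : ∀ {r : Torus n}, r ∈ H₀ → ∀ H, H ∈ membersThrough A r ↔
      H ∈ A ∧ (H = H₀ ∨ (H ≠ H₀ ∧ H₀ ∩ H ∈ membersThrough (restriction A H₀) r)) := by
    intro r hr H
    have e := (membersThrough_restriction hA hL hgen hH₀ hr).1
    constructor
    · intro hH
      refine ⟨hH.1, (eq_or_ne H H₀).imp_right fun hne => ⟨hne, ?_⟩⟩
      rw [e]
      exact ⟨H, ⟨hH, hne⟩, rfl⟩
    · rintro ⟨hH, rfl | ⟨-, h⟩⟩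
      · exact ⟨hH, hr⟩
      · exact ⟨hH, h.2.2⟩
  ext q
  constructor
  · intro hq
    rw [mem_stratum_iff] at hq ⊢
    refine ⟨mem_univ _, ?_⟩
    ext H
    rw [key hq.1, key hp, hq.2]
  · intro hq
    have hq0 : q ∈ H₀ := (hq.2 H₀ hH₀).2 hp
    rw [mem_stratum_iff, (membersThrough_restriction hA hL hgen hH₀ hp).1,
      (membersThrough_restriction hA hL hgen hH₀ hq0).1, membersThrough_eq_of_mem_stratum hq]
    exact ⟨hq0, rfl⟩

/-- The flats of the restriction are the flats of `A` inside `H₀`. -/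
lemma flats_restriction_eq (hA : A.Finite) (hL : ∀ H ∈ A, IsLift H (L H) (c H))
    (hgen : IsGeneralPosition univ n A) {H₀ : Set (Torus n)} (hH₀ : H₀ ∈ A)
    (hgen' : IsGeneralPosition H₀ (n - 1) (restriction A H₀)) (k : ℕ) :
    flats H₀ (n - 1) (restriction A H₀) k =
      {C | ∃ y, torusMk y ∈ H₀ ∧ (membersThrough A (torusMk y)).ncard + k = n ∧
        C = torusMk '' cell A L c y} := by
  have hfin : (restriction A H₀).Finite := by
    refine (hA.image (H₀ ∩ ·)).subset ?_
    rintro _ ⟨H, hH, -, -, rfl⟩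
    exact ⟨H, hH, rfl⟩
  ext C
  rw [mem_flats_iff hfin hgen']
  constructor
  · rintro ⟨p, hp, hk, rfl⟩
    obtain ⟨y, rfl⟩ := torusMk_surjective p
    have h1 := ncard_membersThrough_restriction hA hL hgen hH₀ hp
    -- With `h1` this gives `n ≥ 1`, so `n - 1` is not truncated; the drop in ambient dimension
    -- cancels the loss of the member `H₀`.
    have h2 := ncard_membersThrough_le hA hgen (mem_univ (torusMk y))
    refine ⟨y, hp, by omega, ?_⟩
    rw [stratum_restriction hA hL hgen hH₀ hp, connectedComponentIn_stratum hA hL]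
  · rintro ⟨y, hp, hk, rfl⟩
    have h1 := ncard_membersThrough_restriction hA hL hgen hH₀ hp
    refine ⟨_, hp, by omega, ?_⟩
    rw [stratum_restriction hA hL hgen hH₀ hp, connectedComponentIn_stratum hA hL]

end

/-! ### Two counting lemmas -/

lemma ncard_eq_sum_ncard_subset {α : Type*} {D F : Set (Set α)} (hD : D.Finite) (hF : F.Finite)
    (h : ∀ σ ∈ D, ∃ C ∈ F, σ ⊆ C ∧ ∀ C' ∈ F, σ ⊆ C' → C' = C) :
    D.ncard = ∑ C ∈ hF.toFinset, {σ ∈ D | σ ⊆ C}.ncard := by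
  classical
  choose! g hg hσ huniq using h
  rw [ncard_eq_toFinset_card _ hD, Finset.card_eq_sum_card_fiberwise (f := g) (t := hF.toFinset)
    (fun σ hσ => by simpa using hg σ (by simpa using hσ))]
  refine Finset.sum_congr rfl fun C hC => ?_
  rw [← ncard_coe_finset]
  congr 1
  ext σ
  simp only [Finset.coe_filter, Finite.mem_toFinset, mem_ofPred_eq]
  refine and_congr_right fun hD => ⟨fun h => h ▸ hσ σ hD, fun h => ?_⟩
  exact (huniq σ hD C (hF.mem_toFinset.1 hC) h).symm

/-- An interval which is a neighbourhood of each of its integer points meets one more of the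
intervals `(m, m + 1)` than it contains integers. -/
lemma ncard_floor_eq_ncard_int_add_one {I : Set ℝ} (hI : I.OrdConnected) (hne : I.Nonempty)
    (hnhds : ∀ m : ℤ, (m : ℝ) ∈ I → I ∈ 𝓝 (m : ℝ)) (hfin : {m : ℤ | (m : ℝ) ∈ I}.Finite) :
    {m : ℤ | ∃ t ∈ I, (¬ ∃ j : ℤ, t = j) ∧ ⌊t⌋ = m}.ncard =
      {m : ℤ | (m : ℝ) ∈ I}.ncard + 1 := by
  rcases eq_empty_or_nonempty {m : ℤ | (m : ℝ) ∈ I} with hQ | hQ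
  · obtain ⟨t₀, ht₀⟩ := hne
    have hno : ∀ m : ℤ, (m : ℝ) ∉ I := fun m hm => notMem_empty m (hQ ▸ hm)
    -- Two different floors would put an integer between the two points, hence in `I`.
    have hle : ∀ s ∈ I, ∀ t ∈ I, ⌊s⌋ ≤ ⌊t⌋ := by
      intro s hs t ht
      by_contra! hlt
      exact hno _ (hI.out ht hs ⟨(Int.floor_lt.1 hlt).le, Int.floor_le s⟩)
    have hP : {m : ℤ | ∃ t ∈ I, (¬ ∃ j : ℤ, t = j) ∧ ⌊t⌋ = m} = {⌊t₀⌋} := by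
      ext m
      constructor
      · rintro ⟨t, ht, -, rfl⟩
        exact (hle _ ht _ ht₀).antisymm (hle _ ht₀ _ ht)
      · rintro rfl
        exact ⟨t₀, ht₀, fun ⟨j, hj⟩ => hno j (hj ▸ ht₀), rfl⟩
    rw [hP, hQ, ncard_singleton, ncard_empty]
  · obtain ⟨a, ha, hmin⟩ := exists_min_image _ id hfin hQ
    have hmin' : ∀ m : ℤ, (m : ℝ) ∈ I → a ≤ m := hmin
    have hfl : ∀ {m : ℤ} {t : ℝ}, (m : ℝ) < t → t < m + 1 → (¬ ∃ j : ℤ, t = j) ∧ ⌊t⌋ = m := by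
      intro m t h1 h2
      refine ⟨?_, Int.floor_eq_iff.2 ⟨h1.le, h2⟩⟩
      rintro ⟨j, rfl⟩
      have h1' : m < j := by exact_mod_cast h1
      have h2' : j < m + 1 := by exact_mod_cast h2
      omega
    -- Each integer `m` of `I` accounts for the unit interval on its right; the extra interval lies
    -- to the left of the least integer `a`.
    have hP : {m : ℤ | ∃ t ∈ I, (¬ ∃ j : ℤ, t = j) ∧ ⌊t⌋ = m} =
        insert (a - 1) {m : ℤ | (m : ℝ) ∈ I} := by
      ext m
      constructor
      · rintro ⟨t, ht, -, rfl⟩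
        rcases le_or_gt a ⌊t⌋ with h | h
        · exact Or.inr (hI.out ha ht ⟨by exact_mod_cast h, Int.floor_le t⟩)
        · refine Or.inl ?_
          have h3 : ((⌊t⌋ + 1 : ℤ) : ℝ) ∈ I := by
            refine hI.out ht ha ⟨by push_cast; exact (Int.lt_floor_add_one t).le, ?_⟩
            exact_mod_cast h
          have := hmin' _ h3
          omega
      · rintro (rfl | hm)
        · obtain ⟨ε, hε, hball⟩ := Metric.mem_nhds_iff.1 (hnhds a ha)
          refine ⟨a - min (ε / 2) (1 / 2), hball ?_, hfl ?_ ?_⟩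
          · rw [Metric.mem_ball, Real.dist_eq, sub_sub_cancel_left, abs_neg,
              abs_of_pos (by positivity)]
            exact (min_le_left _ _).trans_lt (by linarith)
          · push_cast
            linarith [min_le_right (ε / 2) (1 / 2)]
          · have : 0 < min (ε / 2) (1 / 2 : ℝ) := by positivity
            push_cast
            linarith
        · obtain ⟨ε, hε, hball⟩ := Metric.mem_nhds_iff.1 (hnhds m hm)
          have : 0 < min (ε / 2) (1 / 2 : ℝ) := by positivity
          refine ⟨m + min (ε / 2) (1 / 2), hball ?_, hfl ?_ ?_⟩
          · rw [Metric.mem_ball, Real.dist_eq, add_sub_cancel_left, abs_of_pos this]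
            exact (min_le_left _ _).trans_lt (by linarith)
          · linarith
          · linarith [min_le_right (ε / 2) (1 / 2)]
    rw [hP, ncard_insert_of_notMem _ hfin]
    intro h
    have := hmin' _ h
    omega

/-! ### Cutting the flats of the deletion by `H₀` -/

section

variable {A : Set (Set (Torus n))} {L : Set (Torus n) → (Fin n → ℝ) →L[ℝ] ℝ}
  {c : Set (Torus n) → ℝ} {y z w : Fin n → ℝ} {H₀ : Set (Torus n)}

lemma membersThrough_deletion {p : Torus n} :
    membersThrough (deletion A H₀) p = membersThrough A p \ {H₀} := by
  ext H
  simp only [membersThrough, deletion, Set.mem_sdiff, mem_singleton_iff, mem_ofPred_eq]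
  tauto

lemma mem_cell_of_mem_deletion (hz : z ∈ cell (deletion A H₀) L c y)
    (hw : w ∈ cell (deletion A H₀) L c y) (h1 : ⌊L H₀ w - c H₀⌋ = ⌊L H₀ z - c H₀⌋)
    (h2 : ⌈L H₀ w - c H₀⌉ = ⌈L H₀ z - c H₀⌉) : w ∈ cell A L c z := by
  intro H hH
  by_cases h : H = H₀
  · subst h; exact ⟨h1, h2⟩
  · have hw' := hw H ⟨hH, h⟩
    have hz' := hz H ⟨hH, h⟩
    exact ⟨hw'.1.trans hz'.1.symm, hw'.2.trans hz'.2.symm⟩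

lemma cell_subset_cell_deletion (hz : z ∈ cell (deletion A H₀) L c y) :
    cell A L c z ⊆ cell (deletion A H₀) L c y :=
  (cell_anti sdiff_subset).trans (cell_eq_of_mem hz).subset

/-- Inside a cell of the deletion on which the covering map is injective, the images of the cells
of `A` are told apart by the position with respect to `H₀`. -/
lemma injOn_image_cell (hH₀ : H₀ ∈ A) (hinj : InjOn torusMk (cell (deletion A H₀) L c y))
    {M : Set ℤ} {s : ℤ → Fin n → ℝ} (hs : ∀ m ∈ M, s m ∈ cell (deletion A H₀) L c y)
    (hfl : ∀ m ∈ M, ⌊L H₀ (s m) - c H₀⌋ = m) :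
    InjOn (fun m => torusMk '' cell A L c (s m)) M := by
  intro m hm m' hm' h
  have h : torusMk '' cell A L c (s m) = torusMk '' cell A L c (s m') := h
  obtain ⟨w, hw, hwm⟩ : torusMk (s m) ∈ torusMk '' cell A L c (s m') :=
    h ▸ ⟨_, mem_cell_self, rfl⟩
  have e := hinj (cell_subset_cell_deletion (hs m' hm') hw) (hs m hm) hwm
  rw [← hfl m hm, ← hfl m' hm', ← e, (hw H₀ hH₀).1]

/-- The image of a cell of `A` that lies in the image of a cell of the deletion is represented
in that cell. -/
lemma exists_representative (hL : ∀ H ∈ A, IsLift H (L H) (c H))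
    (h : torusMk '' cell A L c z ⊆ torusMk '' cell (deletion A H₀) L c y) :
    ∃ w ∈ cell (deletion A H₀) L c y, torusMk w = torusMk z ∧
      torusMk '' cell A L c z = torusMk '' cell A L c w := by
  obtain ⟨w, hw, hwz⟩ := h ⟨z, mem_cell_self, rfl⟩
  exact ⟨w, hw, hwz, image_cell_eq_of_torusMk_eq hL hwz.symm⟩

/-- The flats of `A` outside `H₀` with `r` members of `A` through their points. -/
def flatsOff (A : Set (Set (Torus n))) (L : Set (Torus n) → (Fin n → ℝ) →L[ℝ] ℝ)
    (c : Set (Torus n) → ℝ) (H₀ : Set (Torus n)) (r : ℕ) : Set (Set (Torus n)) :=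
  {C | ∃ z, torusMk z ∉ H₀ ∧ (membersThrough A (torusMk z)).ncard = r ∧
    C = torusMk '' cell A L c z}

/-- The flats of `A` inside `H₀` with `r` members of `A` through their points. -/
def flatsOn (A : Set (Set (Torus n))) (L : Set (Torus n) → (Fin n → ℝ) →L[ℝ] ℝ)
    (c : Set (Torus n) → ℝ) (H₀ : Set (Torus n)) (r : ℕ) : Set (Set (Torus n)) :=
  {C | ∃ z, torusMk z ∈ H₀ ∧ (membersThrough A (torusMk z)).ncard = r ∧
    C = torusMk '' cell A L c z}

lemma finite_flatsOff (hA : A.Finite) (hL : ∀ H ∈ A, IsLift H (L H) (c H)) (r : ℕ) :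
    (flatsOff A L c H₀ r).Finite :=
  (finite_image_cells hA hL).subset fun _ ⟨z, _, _, h⟩ => ⟨z, h⟩

lemma finite_flatsOn (hA : A.Finite) (hL : ∀ H ∈ A, IsLift H (L H) (c H)) (r : ℕ) :
    (flatsOn A L c H₀ r).Finite :=
  (finite_image_cells hA hL).subset fun _ ⟨z, _, _, h⟩ => ⟨z, h⟩

lemma ncard_membersThrough_deletion_of_notMem {p : Torus n} (hp : p ∉ H₀) :
    (membersThrough (deletion A H₀) p).ncard = (membersThrough A p).ncard := by
  rw [membersThrough_deletion, sdiff_singleton_eq_self fun h => hp h.2]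

lemma ncard_membersThrough_deletion_of_mem (hA : A.Finite) (hH₀ : H₀ ∈ A) {p : Torus n}
    (hp : p ∈ H₀) :
    (membersThrough (deletion A H₀) p).ncard + 1 = (membersThrough A p).ncard := by
  rw [membersThrough_deletion]
  exact ncard_sdiff_singleton_add_one ⟨hH₀, hp⟩ (finite_membersThrough hA p)

/-- A cell of the deletion extends transversally to `H₀`. -/
lemma eventually_mem_image_cell_deletion (hA : A.Finite) (hL : ∀ H ∈ A, IsLift H (L H) (c H))
    (hgen : IsGeneralPosition univ n A) (hH₀ : H₀ ∈ A)
    (hz : z ∈ cell (deletion A H₀) L c y) (hz0 : torusMk z ∈ H₀) :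
    (fun w => L H₀ w - c H₀) '' cell (deletion A H₀) L c y ∈ 𝓝 (L H₀ z - c H₀) := by
  have hA' : (deletion A H₀).Finite := hA.subset sdiff_subset
  have hL' : ∀ H ∈ deletion A H₀, IsLift H (L H) (c H) := fun H hH => hL H hH.1
  -- Moving along `v` changes `L H₀` at unit speed and stays on all other members through the point,
  -- hence for small times in the cell of the deletion.
  obtain ⟨v, hv, hv'⟩ := exists_dual_vector hA hL hgen (y := z) ⟨hH₀, hz0⟩
  have hc : ContinuousAt (fun t : ℝ => z + (t - (L H₀ z - c H₀)) • v) (L H₀ z - c H₀) := by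
    fun_prop
  have h := eventually_mem_cell (z := z) hA' hL'
  have hc' := hc.tendsto
  simp only [sub_self, zero_smul, add_zero] at hc'
  filter_upwards [hc'.eventually h] with t ht
  rw [← cell_eq_of_mem hz]
  refine ⟨z + (t - (L H₀ z - c H₀)) • v, ht fun H hH hzH => ?_, ?_⟩
  · obtain ⟨m, hm⟩ := ((hL' H hH).mem_iff z).1 hzH
    refine ((hL' H hH).mem_iff _).2 ⟨m, ?_⟩
    rw [map_add, map_smul, hv' H ⟨hH.1, hzH⟩ hH.2, smul_zero, add_zero, hm]
  · simp only [map_add, map_smul, hv, smul_eq_mul]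
    ring

/-- `H₀` cuts a `k`-flat of the deletion into one more `k`-flat than there are `(k-1)`-flats in
the cut. -/
lemma ncard_flatsOff_subset (hA : A.Finite) (hL : ∀ H ∈ A, IsLift H (L H) (c H))
    (hgen : IsGeneralPosition univ n A) (hH₀ : H₀ ∈ A) {r : ℕ}
    (hy : (membersThrough (deletion A H₀) (torusMk y)).ncard = r)
    (hinj : InjOn torusMk (cell (deletion A H₀) L c y)) :
    {σ ∈ flatsOff A L c H₀ r | σ ⊆ torusMk '' cell (deletion A H₀) L c y}.ncard =
      {τ ∈ flatsOn A L c H₀ (r + 1) |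
        τ ⊆ torusMk '' cell (deletion A H₀) L c y}.ncard + 1 := by
  have hL' : ∀ H ∈ deletion A H₀, IsLift H (L H) (c H) := fun H hH => hL H hH.1
  set G := cell (deletion A H₀) L c y with hG
  set I := (fun w => L H₀ w - c H₀) '' G with hI
  have hmem := (hL H₀ hH₀).mem_iff
  have hcount : ∀ w ∈ G, (membersThrough (deletion A H₀) (torusMk w)).ncard = r := by
    intro w hw
    rw [membersThrough_eq_of_mem_stratum (image_cell_subset_stratum hL' ⟨w, hw, rfl⟩), hy]
  -- `s m` and `u m` are points of `G` above the unit interval `(m, m + 1)` and above the integer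
  -- `m` respectively.
  choose! s hsG hs using fun (m : ℤ) (hm : ∃ t ∈ I, (¬ ∃ j : ℤ, t = j) ∧ ⌊t⌋ = m) =>
    show ∃ w ∈ G, torusMk w ∉ H₀ ∧ ⌊L H₀ w - c H₀⌋ = m by
      obtain ⟨_, ⟨w, hw, rfl⟩, h1, h2⟩ := hm
      exact ⟨w, hw, (hmem w).not.2 h1, h2⟩
  choose! u huG hu using fun (m : ℤ) (hm : (m : ℝ) ∈ I) => hm
  have hoff : (fun m => torusMk '' cell A L c (s m)) ''
      {m : ℤ | ∃ t ∈ I, (¬ ∃ j : ℤ, t = j) ∧ ⌊t⌋ = m} =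
        {σ ∈ flatsOff A L c H₀ r | σ ⊆ torusMk '' G} := by
    ext σ
    constructor
    · rintro ⟨m, hm, rfl⟩
      refine ⟨⟨s m, (hs m hm).1, ?_, rfl⟩, image_mono (cell_subset_cell_deletion (hsG m hm))⟩
      rw [← ncard_membersThrough_deletion_of_notMem (hs m hm).1, hcount _ (hsG m hm)]
    · rintro ⟨⟨z, hz, -, rfl⟩, hzG⟩
      obtain ⟨w, hw, hwz, e⟩ := exists_representative hL hzG
      have hw0 : torusMk w ∉ H₀ := hwz ▸ hz
      have hm : ∃ t ∈ I, (¬ ∃ j : ℤ, t = j) ∧ ⌊t⌋ = ⌊L H₀ w - c H₀⌋ :=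
        ⟨_, ⟨w, hw, rfl⟩, (hmem w).not.1 hw0, rfl⟩
      refine ⟨_, hm, ?_⟩
      -- Off `H₀` the floor determines the ceiling, so it alone fixes the cell of `A` within `G`.
      have hceil : ∀ x, torusMk x ∉ H₀ → ⌈L H₀ x - c H₀⌉ = ⌊L H₀ x - c H₀⌋ + 1 := by
        intro x hx
        have h1 := (hmem x).not.1 hx
        rw [exists_eq_intCast_iff] at h1
        have h2 := Int.ceil_le_floor_add_one (L H₀ x - c H₀)
        have h3 := Int.floor_le_ceil (L H₀ x - c H₀)
        omega
      have hsm := hs _ hm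
      rw [e]
      simp only
      rw [cell_eq_of_mem (mem_cell_of_mem_deletion hw (hsG _ hm) hsm.2 ?_)]
      rw [hceil _ hsm.1, hceil _ hw0, hsm.2]
  have hon : (fun m => torusMk '' cell A L c (u m)) '' {m : ℤ | (m : ℝ) ∈ I} =
      {τ ∈ flatsOn A L c H₀ (r + 1) | τ ⊆ torusMk '' G} := by
    ext τ
    constructor
    · rintro ⟨m, hm, rfl⟩
      have h0 : torusMk (u m) ∈ H₀ := (hmem _).2 ⟨m, hu m hm⟩
      refine ⟨⟨u m, h0, ?_, rfl⟩, image_mono (cell_subset_cell_deletion (huG m hm))⟩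
      rw [← ncard_membersThrough_deletion_of_mem hA hH₀ h0, hcount _ (huG m hm)]
    · rintro ⟨⟨z, hz, -, rfl⟩, hzG⟩
      obtain ⟨w, hw, hwz, e⟩ := exists_representative hL hzG
      obtain ⟨m, hm⟩ := (hmem w).1 (hwz ▸ hz)
      have hmI : (m : ℝ) ∈ I := ⟨w, hw, hm⟩
      refine ⟨m, hmI, ?_⟩
      have e' : L H₀ (u m) - c H₀ = L H₀ w - c H₀ := (hu m hmI).trans hm.symm
      rw [e]
      simp only
      rw [cell_eq_of_mem (mem_cell_of_mem_deletion hw (huG _ hmI) (by rw [e']) (by rw [e']))]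
  have hinj_off := injOn_image_cell hH₀ hinj hsG fun m hm => (hs m hm).2
  have hinj_on := injOn_image_cell hH₀ hinj (M := {m : ℤ | (m : ℝ) ∈ I}) huG
    fun m hm => by rw [show L H₀ (u m) - c H₀ = m from hu m hm, Int.floor_intCast]
  -- Different integers of `I` give different flats of `A`, of which there are finitely many.
  have hfin : {m : ℤ | (m : ℝ) ∈ I}.Finite := by
    refine Finite.of_finite_image ?_ hinj_on
    rw [hon]
    exact (finite_flatsOn hA hL _).subset (sep_subset _ _)
  rw [← hoff, ← hon]
  refine hinj_off.ncard_image.trans (.trans ?_ (congrArg (· + 1) hinj_on.ncard_image.symm))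
  refine ncard_floor_eq_ncard_int_add_one ?_ ⟨_, y, mem_cell_self, rfl⟩ ?_ hfin
  · refine (IsPreconnected.image convex_cell.isPreconnected _ ?_).ordConnected
    fun_prop
  · rintro m ⟨z, hz, hm⟩
    have hm : L H₀ z - c H₀ = m := hm
    rw [← hm]
    exact eventually_mem_image_cell_deletion hA hL hgen hH₀ hz ((hmem z).2 ⟨m, hm⟩)

/-- The `k`-flats of `A` off `H₀` are counted by the `k`-flats of the deletion and the
`(k-1)`-flats in `H₀`. -/
lemma ncard_flatsOff (hA : A.Finite) (hL : ∀ H ∈ A, IsLift H (L H) (c H))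
    (hgen : IsGeneralPosition univ n A) (hH₀ : H₀ ∈ A)
    (hgen' : IsGeneralPosition univ n (deletion A H₀))
    (hsc : FlatsSimplyConnected univ n (deletion A H₀)) {k r : ℕ} (hr : r + k = n) :
    (flatsOff A L c H₀ r).ncard =
      (flats univ n (deletion A H₀) k).ncard + (flatsOn A L c H₀ (r + 1)).ncard := by
  have hA' : (deletion A H₀).Finite := hA.subset sdiff_subset
  have hL' : ∀ H ∈ deletion A H₀, IsLift H (L H) (c H) := fun H hH => hL H hH.1
  have hflats := flats_univ_eq hA' hL' hgen' k
  have hF : (flats univ n (deletion A H₀) k).Finite := by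
    rw [hflats]
    exact (finite_image_cells hA' hL').subset fun _ ⟨z, _, h⟩ => ⟨z, h⟩
  -- Images of cells of the deletion are disjoint or equal, so only one of them contains a given
  -- flat of `A`.
  have hfib : ∀ z, (membersThrough (deletion A H₀) (torusMk z)).ncard = r →
      ∃ C ∈ flats univ n (deletion A H₀) k, torusMk '' cell A L c z ⊆ C ∧
        ∀ C' ∈ flats univ n (deletion A H₀) k, torusMk '' cell A L c z ⊆ C' → C' = C := by
    intro z hz
    refine ⟨torusMk '' cell (deletion A H₀) L c z, ?_, image_mono (cell_anti sdiff_subset), ?_⟩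
    · rw [hflats]
      exact ⟨z, by omega, rfl⟩
    · intro C' hC' hsub
      rw [hflats] at hC'
      obtain ⟨y, -, rfl⟩ := hC'
      exact (image_cell_eq_of_mem hL' (hsub ⟨z, mem_cell_self, rfl⟩)).symm
  rw [ncard_eq_sum_ncard_subset (finite_flatsOff hA hL r) hF ?_,
    ncard_eq_sum_ncard_subset (finite_flatsOn hA hL (r + 1)) hF ?_, ncard_eq_toFinset_card _ hF,
    Finset.card_eq_sum_ones, ← Finset.sum_add_distrib]
  · refine Finset.sum_congr rfl fun C hC => ?_
    have hC : C ∈ flats univ n (deletion A H₀) k := hF.mem_toFinset.1 hC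
    have hsC := hsc k C hC
    rw [hflats] at hC
    obtain ⟨y, hy, rfl⟩ := hC
    rw [ncard_flatsOff_subset hA hL hgen hH₀ (by omega) (injOn_torusMk_cell hsC), add_comm]
  · rintro _ ⟨z, hz, hzr, rfl⟩
    refine hfib z ?_
    have := ncard_membersThrough_deletion_of_mem hA hH₀ hz
    omega
  · rintro _ ⟨z, hz, hzr, rfl⟩
    exact hfib z (by rw [ncard_membersThrough_deletion_of_notMem hz, hzr])

/-- Membership in `H₀` is constant on a cell of `A`, so no flat is counted twice. -/
lemma ncard_flats_eq (hA : A.Finite) (hL : ∀ H ∈ A, IsLift H (L H) (c H))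
    (hgen : IsGeneralPosition univ n A) (hH₀ : H₀ ∈ A) {k r : ℕ} (hr : r + k = n) :
    (flats univ n A k).ncard = (flatsOff A L c H₀ r).ncard + (flatsOn A L c H₀ r).ncard := by
  have h : flats univ n A k = flatsOff A L c H₀ r ∪ flatsOn A L c H₀ r := by
    rw [flats_univ_eq hA hL hgen]
    ext C
    constructor
    · rintro ⟨z, hz, rfl⟩
      by_cases h : torusMk z ∈ H₀
      · exact Or.inr ⟨z, h, by omega, rfl⟩
      · exact Or.inl ⟨z, h, by omega, rfl⟩
    · rintro (⟨z, -, hz, rfl⟩ | ⟨z, -, hz, rfl⟩) <;> exact ⟨z, by omega, rfl⟩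
  rw [h, ncard_union_eq ?_ (finite_flatsOff hA hL r) (finite_flatsOn hA hL r)]
  rw [disjoint_left]
  rintro _ ⟨z, hz, -, rfl⟩ ⟨w, hw, -, e⟩
  obtain ⟨x, hx, hxz⟩ : torusMk z ∈ torusMk '' cell A L c w := e ▸ ⟨z, mem_cell_self, rfl⟩
  exact hz (hxz ▸ (mem_iff_of_mem_cell hL hx hH₀).2 hw)

end

end ToricArrangement

theorem mainTheorem2 (n : ℕ) (A : Set (Set (Torus n))) (hA : IsToricArrangement A)
    (H₀ : Set (Torus n)) (hH₀ : H₀ ∈ A) (hcard : n + 1 ≤ A.ncard)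
    (hspan : ToricArrangement.IsSpanning univ n A)
    (hspan' : ToricArrangement.IsSpanning univ n (ToricArrangement.deletion A H₀))
    (hspan'' : ToricArrangement.IsSpanning H₀ (n - 1) (ToricArrangement.restriction A H₀))
    (hgen : ToricArrangement.IsGeneralPosition univ n A)
    (hgen' : ToricArrangement.IsGeneralPosition univ n (ToricArrangement.deletion A H₀))
    (hgen'' : ToricArrangement.IsGeneralPosition H₀ (n - 1) (ToricArrangement.restriction A H₀))
    (hsc : ToricArrangement.FlatsSimplyConnected univ n A)
    (hsc' : ToricArrangement.FlatsSimplyConnected univ n (ToricArrangement.deletion A H₀))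
    (hsc'' : ToricArrangement.FlatsSimplyConnected H₀ (n - 1)
      (ToricArrangement.restriction A H₀)) :
    (∀ k : ℕ, (ToricArrangement.flats univ n A k).Finite ∧
      (ToricArrangement.flats univ n (ToricArrangement.deletion A H₀) k).Finite ∧
      (ToricArrangement.flats H₀ (n - 1) (ToricArrangement.restriction A H₀) k).Finite) ∧
    ∀ k : ℕ, k ≤ n →
      ToricArrangement.numFlats univ n A k =
        ToricArrangement.numFlats univ n (ToricArrangement.deletion A H₀) k +
        ToricArrangement.numFlats H₀ (n - 1) (ToricArrangement.restriction A H₀) k +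
        ToricArrangement.numFlats H₀ (n - 1) (ToricArrangement.restriction A H₀) ((k : ℤ) - 1) := by
  open ToricArrangement in
  have hfin := hA.1
  choose! L c hL using fun H (hH : H ∈ A) => (hA.2 H hH).exists_isLift
  have hfin' : (deletion A H₀).Finite := hfin.subset sdiff_subset
  have hL' : ∀ H ∈ deletion A H₀, IsLift H (L H) (c H) := fun H hH => hL H hH.1
  have hres : ∀ {k r : ℕ}, r + k = n →
      flats H₀ (n - 1) (restriction A H₀) k = flatsOn A L c H₀ r := by
    intro k r hr
    rw [flats_restriction_eq hfin hL hgen hH₀ hgen'']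
    ext C
    refine exists_congr fun y => and_congr_right fun _ => and_congr_left fun _ => ?_
    omega
  refine ⟨fun k => ⟨?_, ?_, ?_⟩, fun k hk => ?_⟩
  · rw [flats_univ_eq hfin hL hgen]
    exact (finite_image_cells hfin hL).subset fun _ ⟨z, _, h⟩ => ⟨z, h⟩
  · rw [flats_univ_eq hfin' hL' hgen']
    exact (finite_image_cells hfin' hL').subset fun _ ⟨z, _, h⟩ => ⟨z, h⟩
  · rw [flats_restriction_eq hfin hL hgen hH₀ hgen'']
    exact (finite_image_cells hfin hL).subset fun _ ⟨z, _, _, h⟩ => ⟨z, h⟩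
  obtain ⟨r, hr⟩ : ∃ r, r + k = n := ⟨n - k, by omega⟩
  have hlow : numFlats H₀ (n - 1) (restriction A H₀) ((k : ℤ) - 1) =
      (flatsOn A L c H₀ (r + 1)).ncard := by
    rcases k with _ | j
    -- For `k = 0` these flats would consist of points on `n + 1` members, which general position
    -- excludes; this matches `f_{-1} = 0`.
    · have hempty : flatsOn A L c H₀ (r + 1) = ∅ := by
        rw [eq_empty_iff_forall_notMem]
        rintro _ ⟨z, -, hz, -⟩
        have := ncard_membersThrough_le hfin hgen (mem_univ (torusMk z))
        omega
      rw [hempty, ncard_empty]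
      rfl
    · rw [← hres (k := j) (by omega), show ((j + 1 : ℕ) : ℤ) - 1 = (j : ℤ) by push_cast; ring]
      rfl
  rw [hlow]
  change (flats univ n A k).ncard = (flats univ n (deletion A H₀) k).ncard +
    (flats H₀ (n - 1) (restriction A H₀) k).ncard + _
  rw [hres hr, ncard_flats_eq hfin hL hgen hH₀ hr,
    ncard_flatsOff hfin hL hgen hH₀ hgen' hsc' hr]
  ring
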